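/- **Setting.** Let $d\in\mathbb N$ and $B,\alpha,D>0$. For a nonempty set $\mathcal X\subseteq\mathbb R^d$, let $\mathcal O_{\tt sc}(\mathcal X)$ be the set of all pairs $(f,O)$ where $f$ is a convex function on (the convex set) $\mathcal X$ that is $\alpha$-strongly convex, i.e. $x\mapsto f(x)-\frac{\alpha}{2}\|x\|_2^2$ is convex on $\mathcal X$, and $O$ is a stochastic first-order oracle: queried at $x\in\mathcal X$ it outputs a fresh random vector $\hat g(x)\in\mathbb R^d$, whose law depends only on $x$ (measurably), such that $\mathbb E[\hat g(x)\mid x]\in\partial f(x)$ and $\|\hat g(x)\|_2^2\le B^2$ almost surely. Here $\partial f(x)=\{g: f(y)\ge f(x)+\langle g,y-x\rangle\ \forall y\in\mathcal X\}$. For $\varepsilon\ge 0$, let $\mathcal W_{{\tt priv},\varepsilon}$ be the set of all $\varepsilon$-locally differentially private channels, i.e. Markov kernels $W$ from $\mathbb R^d$ to $\mathbb R^d$ with $W(S\mid x)\le e^{\varepsilon}W(S\mid x')$ for all $x,x'\in\mathbb R^d$ and all Borel sets $S$. An adaptive channel selection strategy $S=(S_1,\dots,S_T)$ chooses the channel $W_t=S_t(Y_1,\dots,Y_{t-1})\in\mathcal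 W_{{\tt priv},\varepsilon}$ of round $t$ as a measurable function of the previous channel outputs. A first-order algorithm $\pi$ with $T$ queries has a private random seed; at round $t$ it queries a point $x_t\in\mathcal X$ depending on the seed and $Y_1,\dots,Y_{t-1}$, the oracle draws $\hat g(x_t)$, and $\pi$ observes only $Y_t\sim W_t(\cdot\mid\hat g(x_t))$; after $T$ rounds it outputs a point $\hat x\in\mathcal X$ depending on the seed and $Y_1,\dots,Y_T$. The adaptive minmax error is $$\mathcal E^*(\mathcal X,\mathcal O_{\tt sc},T,\mathcal W_{{\tt priv},\varepsilon})=\inf_{\pi}\inf_{S}\sup_{(f,O)\in\mathcal O_{\tt sc}(\mathcal X)}\mathbb E\big[f(\hat x)-\inf_{x\in\mathcal X}f(x)\big]$$ (a supremum over the empty set being $0$), and $\mathbb X_2(D)$ is the collection of nonempty subsets $\mathcal X\subseteq\mathbb R^d$ with $\|x-y\|_2\le D$ for all $x,y\in\mathcal X$. **Theorem.** There exist absolute constants $c_0,c_1>0$ such that for all $d$, all $B,\alpha,D>0$ with $\frac{B}{\alpha}\ge\frac{D}{8}$, all $\varepsilon\in[0,1]$ and all $T\in\mathbb N$ with $T\ge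 c_0\cdot\frac{B^2}{\alpha^2D^2}\cdot\frac{d}{\varepsilon^2}$ (for $\varepsilon=0$ the right-hand side is infinite and nothing is claimed), $$\sup_{\mathcal X\in\mathbb X_2(D)}\mathcal E^*(\mathcal X,\mathcal O_{\tt sc},T,\mathcal W_{{\tt priv},\varepsilon})\ \ge\ c_1\cdot\frac{B^2}{\alpha T}\cdot\frac{d}{\varepsilon^2}.$$ -/

import Mathlib

open MeasureTheory ProbabilityTheory
open scoped ENNReal

noncomputable section

namespace PrivOpt

/-- The space `ℝ^d` with its Euclidean norm. -/
abbrev E (d : ℕ) : Type := EuclideanSpace ℝ (Fin d)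

/-! ### Functions and first-order oracles -/

/-- The subgradient set at `x` of a function `f` on the domain `X`. -/
def subgradients {d : ℕ} (X : Set (E d)) (f : E d → ℝ) (x : E d) : Set (E d) :=
  {g | ∀ y ∈ X, f x + inner ℝ g (y - x) ≤ f y}

/-- The nonempty subsets of `ℝ^d` whose `ℓ₂` diameter is at most `D`. -/
def domains₂ (d : ℕ) (D : ℝ) : Set (Set (E d)) :=
  {X | X.Nonempty ∧ ∀ x ∈ X, ∀ y ∈ X, ‖x - y‖ ≤ D}

/-- The pairs `(f, O)` of an `α`-strongly convex function `f` on `X` and a stochastic first-order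
oracle `O` for it: queried at `x ∈ X`, the oracle outputs a random vector with law `O x`, whose
mean is a subgradient of `f` at `x` and whose `ℓ₂` norm is almost surely at most `B`.
Only the values of `f` on `X` matter; `ConvexOn` contains the convexity of `X`. -/
def stronglyConvexClass {d : ℕ} (X : Set (E d)) (B α : ℝ) : Set ((E d → ℝ) × Kernel X (E d)) :=
  {p | ConvexOn ℝ X p.1 ∧
    ConvexOn ℝ X (fun x => p.1 x - α / 2 * ‖x‖ ^ 2) ∧
    IsMarkovKernel p.2 ∧
    (∀ x : X, (∫ g, g ∂(p.2 x)) ∈ subgradients X p.1 x) ∧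
    (∀ x : X, ∀ᵐ g ∂(p.2 x), ‖g‖ ^ 2 ≤ B ^ 2)}

/-! ### Channels -/

/-- The family of `ε`-locally differentially private channels `ℝ^d → ℝ^d`. -/
def ldpChannels (d : ℕ) (ε : ℝ) : Set (Kernel (E d) (E d)) :=
  {W | IsMarkovKernel W ∧
    ∀ x x' : E d, ∀ s : Set (E d), MeasurableSet s →
      W x s ≤ ENNReal.ofReal (Real.exp ε) * W x' s}

/-- Adaptive channel selection strategies over `T` rounds: the channel of round `t` is a member of
the family `𝒲` chosen as a (jointly measurable) function of the previous channel outputs. -/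
structure ChannelStrategy {d : ℕ} (𝒲 : Set (Kernel (E d) (E d))) (T : ℕ) where
  channel : (t : Fin T) → (Fin t → E d) → Kernel (E d) (E d)
  mem : ∀ (t : Fin T) (h : Fin t → E d), channel t h ∈ 𝒲
  measurable_channel : ∀ t : Fin T, Measurable fun p : (Fin t → E d) × E d => channel t p.1 p.2

/-- The channel of round `t` as a kernel in the previous outputs and the channel input. -/
def ChannelStrategy.kernel {d : ℕ} {𝒲 : Set (Kernel (E d) (E d))} {T : ℕ}
    (S : ChannelStrategy 𝒲 T) (t : Fin T) : Kernel ((Fin t → E d) × E d) (E d) where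
  toFun p := S.channel t p.1 p.2
  measurable' := S.measurable_channel t

/-! ### Optimization algorithms -/

/-- (Randomized) first-order optimization algorithms on the domain `X` making `T` queries. The
algorithm draws a private random seed; its `t`-th query is a function of the seed and of the
channel outputs of the earlier rounds, and its final point is a function of the seed and of all
`T` channel outputs. -/
structure Algorithm {d : ℕ} (X : Set (E d)) (T : ℕ) where
  Seed : Type
  [instSeed : MeasurableSpace Seed]
  seedLaw : Measure Seed
  [isProb : IsProbabilityMeasure seedLaw]
  query : (t : Fin T) → Seed × (Fin t → E d) → X
  measurable_query : ∀ t : Fin T, Measurable (query t)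
  output : Seed × (Fin T → E d) → X
  measurable_output : Measurable output

attribute [instance] Algorithm.instSeed Algorithm.isProb

/-- Conditional law of the channel output of round `t`, given the seed and the previous outputs:
query a point, draw a gradient estimate from the oracle, pass it through the selected channel. -/
def roundKernel {d : ℕ} {X : Set (E d)} {𝒲 : Set (Kernel (E d) (E d))} {T : ℕ}
    (O : Kernel X (E d)) (π : Algorithm X T) (S : ChannelStrategy 𝒲 T) (t : Fin T) :
    Kernel (π.Seed × (Fin t → E d)) (E d) :=
  Kernel.snd
    ((O.comap (π.query t) (π.measurable_query t)) ⊗ₖ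
      ((S.kernel t).comap
        (fun p : (π.Seed × (Fin t → E d)) × E d => (p.1.2, p.2)) (by fun_prop)))

/-- Joint law of the seed and of the first `t` channel outputs. -/
def transcript {d : ℕ} {X : Set (E d)} {𝒲 : Set (Kernel (E d) (E d))} {T : ℕ}
    (O : Kernel X (E d)) (π : Algorithm X T) (S : ChannelStrategy 𝒲 T) :
    (t : ℕ) → t ≤ T → Measure (π.Seed × (Fin t → E d))
  | 0, _ => π.seedLaw.map (fun u => (u, Fin.elim0))
  | t + 1, ht =>
      ((transcript O π S t (Nat.le_of_succ_le ht)) ⊗ₘ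
          (roundKernel O π S ⟨t, ht⟩ : Kernel (π.Seed × (Fin t → E d)) (E d))).map
        (fun p => (p.1.1, (Fin.snoc p.1.2 p.2 : Fin (t + 1) → E d)))

/-- The expected optimality gap `𝔼[f(x̂) - inf_X f]` of the final point. -/
def optError {d : ℕ} {X : Set (E d)} {𝒲 : Set (Kernel (E d) (E d))} {T : ℕ}
    (f : E d → ℝ) (O : Kernel X (E d)) (π : Algorithm X T) (S : ChannelStrategy 𝒲 T) : ℝ≥0∞ :=
  ∫⁻ p, ENNReal.ofReal (f (π.output p) - ⨅ z : X, f z) ∂(transcript O π S T le_rfl)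

/-- The adaptive minmax optimization error. -/
def minmaxError {d : ℕ} (X : Set (E d)) (𝒪 : Set ((E d → ℝ) × Kernel X (E d))) (T : ℕ)
    (𝒲 : Set (Kernel (E d) (E d))) : ℝ≥0∞ :=
  ⨅ π : Algorithm X T, ⨅ S : ChannelStrategy 𝒲 T, ⨆ p ∈ 𝒪, optError p.1 p.2 π S

end PrivOpt

end

/-! On a ball, minimizing the quadratic `α/2 ‖x - b v‖²` with an unknown sign vector `v` is the same
as estimating `v`: the gap is `α b² / 2` times the squared error of `x / b`. The oracle answers `α x
- c u`, where `u` is a random sign vector whose independent coordinates have bias `δ` towards `v`.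
This gives `b = c δ / α`, and each answer carries little information on `v`.

Privacy shrinks that information further. Given the past, one channel output is a mixture over `u`
with weights depending on `v` and components that do not. Relative to the mixture the components
have densities `w u` within `2ε` of `1`. Flipping coordinate `i` of `v` yields a likelihood ratio `ℓ
i` for which `ℓ i - 1` is the inner product of `w - 1` with the score of coordinate `i`. The scores
are orthogonal, so Bessel's inequality (`sum_sq_sum_weight_flipBit_sub_le`) bounds the sum over all
`i` of `(ℓ i - 1)²` by a constant times `δ² ε²`, with no factor `d`
(`exists_roundKernel_densities`). As everything is conditional on the past, adaptivity does no harm: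
the chain rule bounds the summed relative entropies of the transcripts by `64 T δ² ε²`
(`exists_transcript_densities`).

If this is at most `d / 6`, an Assouad argument (`exists_le_sum_integral_sq_sub_sgn`) forces squared
error `d / 4` for some `v`, hence a gap of at least `α b² d / 8`. Taking `δ² = d / (384 T ε²)` and
`c` of order `B / √d` gives the rate. -/

namespace PrivOpt

/-! ### Product distributions on the sign cube -/

/-- The sign `±1` encoded by a Boolean. -/
noncomputable def sgn (b : Bool) : ℝ := if b then 1 else -1

lemma sgn_not (b : Bool) : sgn (!b) = -sgn b := by cases b <;> simp [sgn]

lemma sgn_sq (b : Bool) : sgn b ^ 2 = 1 := by cases b <;> simp [sgn]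

/-- Flip the `i`-th bit. -/
def flipBit {d : ℕ} (i : Fin d) (v : Fin d → Bool) : Fin d → Bool :=
  Function.update v i (!(v i))

lemma flipBit_involutive {d : ℕ} (i : Fin d) : Function.Involutive (flipBit i) := by
  intro v
  simp [flipBit]

/-- The mass of a single sign `b` under bias `δ` towards `a`. -/
noncomputable def bitWeight (δ : ℝ) (a b : Bool) : ℝ := (1 + δ * sgn a * sgn b) / 2

/-- The mass of `u` under the product distribution on the cube with bias `δ` towards `v`. -/
noncomputable def weight {d : ℕ} (δ : ℝ) (v u : Fin d → Bool) : ℝ := ∏ j, bitWeight δ (v j) (u j)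

section weight

variable {d : ℕ} {δ : ℝ}

lemma bitWeight_pos (h0 : 0 ≤ δ) (h1 : δ < 1) (a b : Bool) : 0 < bitWeight δ a b := by
  cases a <;> cases b <;> simp [bitWeight, sgn] <;> linarith

lemma weight_pos (h0 : 0 ≤ δ) (h1 : δ < 1) (v u : Fin d → Bool) : 0 < weight δ v u :=
  Finset.prod_pos fun _ _ => bitWeight_pos h0 h1 _ _

lemma sum_weight_mul_prod (v : Fin d → Bool) (g : Fin d → Bool → ℝ) :
    ∑ u, weight δ v u * ∏ j, g j (u j) = ∏ j, ∑ b, bitWeight δ (v j) b * g j b := by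
  rw [Finset.prod_univ_sum, Fintype.piFinset_univ]
  simp only [weight, Finset.prod_mul_distrib]

lemma sum_bitWeight (a : Bool) : ∑ b, bitWeight δ a b = 1 := by
  cases a <;> simp [bitWeight, sgn] <;> ring

lemma sum_weight (v : Fin d → Bool) : ∑ u, weight δ v u = 1 := by
  have := sum_weight_mul_prod (δ := δ) v (fun _ _ => 1)
  simpa only [Finset.prod_const_one, mul_one, sum_bitWeight] using this

lemma sum_weight_mul_coord (v : Fin d → Bool) (i : Fin d) (g : Bool → ℝ) :
    ∑ u, weight δ v u * g (u i) = ∑ b, bitWeight δ (v i) b * g b := by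
  have := sum_weight_mul_prod (δ := δ) v (fun j b => if j = i then g b else 1)
  simp only [Finset.prod_ite_eq', Finset.mem_univ, if_true] at this
  rw [this, Finset.prod_eq_single i]
  · simp
  · intro j _ hj
    simp only [if_neg hj, mul_one, sum_bitWeight]
  · simp

lemma sum_weight_mul_coord_mul_coord (v : Fin d → Bool) {i k : Fin d} (hik : i ≠ k)
    (g h : Bool → ℝ) :
    ∑ u, weight δ v u * (g (u i) * h (u k)) =
      (∑ b, bitWeight δ (v i) b * g b) * ∑ b, bitWeight δ (v k) b * h b := by
  have := sum_weight_mul_prod (δ := δ) v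
    (fun j b => (if j = i then g b else 1) * (if j = k then h b else 1))
  simp only [Finset.prod_mul_distrib, Finset.prod_ite_eq', Finset.mem_univ, if_true] at this
  rw [this, ← Finset.prod_subset (Finset.subset_univ {i, k}), Finset.prod_pair hik]
  · simp [hik, hik.symm]
  · intro j _ hj
    simp only [Finset.mem_insert, Finset.mem_singleton, not_or] at hj
    simp only [if_neg hj.1, if_neg hj.2, mul_one, sum_bitWeight]

lemma sum_weight_mul_sgn (v : Fin d → Bool) (i : Fin d) :
    ∑ u, weight δ v u * sgn (u i) = δ * sgn (v i) := by
  rw [sum_weight_mul_coord]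
  cases v i <;> simp [bitWeight, sgn] <;> ring

/-- The relative change of the mass of a sign when the bias is reversed. -/
noncomputable def bitScore (δ : ℝ) (a b : Bool) : ℝ :=
  -2 * δ * sgn a * sgn b / (1 + δ * sgn a * sgn b)

/-- Only the factor at `i` changes, so differences of weights become inner products with a function
of `u i` alone. -/
lemma weight_flipBit_sub (h0 : 0 ≤ δ) (h1 : δ < 1) (v u : Fin d → Bool) (i : Fin d) :
    weight δ (flipBit i v) u - weight δ v u = weight δ v u * bitScore δ (v i) (u i) := by
  have h : ∀ w : Fin d → Bool, weight δ w u =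
      bitWeight δ (w i) (u i) * ∏ j ∈ Finset.univ.erase i, bitWeight δ (w j) (u j) := fun w =>
    (Finset.mul_prod_erase _ _ (Finset.mem_univ i)).symm
  have h2 : ∏ j ∈ Finset.univ.erase i, bitWeight δ (flipBit i v j) (u j) =
      ∏ j ∈ Finset.univ.erase i, bitWeight δ (v j) (u j) := by
    refine Finset.prod_congr rfl fun j hj => ?_
    rw [flipBit, Function.update_of_ne (Finset.ne_of_mem_erase hj)]
  have h3 : 1 + δ * sgn (v i) * sgn (u i) ≠ 0 := by
    have := bitWeight_pos h0 h1 (v i) (u i)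
    unfold bitWeight at this
    intro h
    rw [h] at this
    simp at this
  rw [h, h v, h2]
  simp only [flipBit, Function.update_self, bitWeight, bitScore, sgn_not]
  field_simp
  ring

/-- Centring, together with independence of the coordinates, makes scores of different coordinates
orthogonal. -/
lemma sum_bitWeight_mul_bitScore (h0 : 0 ≤ δ) (h1 : δ < 1) (a : Bool) :
    ∑ b, bitWeight δ a b * bitScore δ a b = 0 := by
  have : 1 + δ ≠ 0 := by linarith
  have : 1 + -δ ≠ 0 := by linarith
  cases a <;> simp [bitWeight, bitScore, sgn] <;> field_simp <;> ring

lemma sum_bitWeight_mul_bitScore_sq (h0 : 0 ≤ δ) (h1 : δ < 1) (a : Bool) :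
    ∑ b, bitWeight δ a b * bitScore δ a b ^ 2 = 4 * δ ^ 2 / (1 - δ ^ 2) := by
  have h2 : 1 + δ ≠ 0 := by linarith
  have h3 : 1 + -δ ≠ 0 := by linarith
  have : 1 - δ ^ 2 ≠ 0 := by
    have : 1 - δ ^ 2 = (1 + δ) * (1 + -δ) := by ring
    rw [this]
    exact mul_ne_zero h2 h3
  cases a <;> simp [bitWeight, bitScore, sgn] <;> field_simp <;> ring

/-- Bessel's inequality for the scores of the coordinates of the product distribution. -/
lemma sum_sq_sum_weight_flipBit_sub_le (h0 : 0 ≤ δ) (h1 : δ < 1) (v : Fin d → Bool)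
    (f : (Fin d → Bool) → ℝ) :
    ∑ i, (∑ u, (weight δ (flipBit i v) u - weight δ v u) * f u) ^ 2 ≤
      4 * δ ^ 2 / (1 - δ ^ 2) * ∑ u, weight δ v u * f u ^ 2 := by
  -- The case `δ = 0` is separate because the argument ends by cancelling the factor `σ`.
  rcases h0.eq_or_lt with rfl | hpos
  · simp [weight, bitWeight]
  set σ : ℝ := 4 * δ ^ 2 / (1 - δ ^ 2) with hσ
  have hσpos : 0 < σ := by
    have : δ ^ 2 < 1 := by nlinarith
    exact div_pos (by positivity) (by linarith)
  set a : Fin d → ℝ := fun i => ∑ u, weight δ v u * (bitScore δ (v i) (u i) * f u) with ha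
  have ha' : ∀ i, ∑ u, (weight δ (flipBit i v) u - weight δ v u) * f u = a i := by
    intro i
    refine Finset.sum_congr rfl fun u _ => ?_
    rw [weight_flipBit_sub h0 h1, mul_assoc]
  simp only [ha']
  -- The scores are orthogonal with squared norm `σ`, so `g` is `σ` times the projection of `f` onto
  -- their span. Bessel's inequality follows by expanding the squared norm of `σ f - g`.
  set g : (Fin d → Bool) → ℝ := fun u => ∑ i, a i * bitScore δ (v i) (u i) with hg
  have hfg : ∑ u, weight δ v u * (f u * g u) = ∑ i, a i ^ 2 := by
    simp only [hg, Finset.mul_sum]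
    rw [Finset.sum_comm]
    refine Finset.sum_congr rfl fun i _ => ?_
    rw [sq]
    nth_rewrite 3 [ha]
    rw [Finset.mul_sum]
    exact Finset.sum_congr rfl fun u _ => by ring
  have hgg : ∑ u, weight δ v u * g u ^ 2 = σ * ∑ i, a i ^ 2 := by
    have : ∀ i k, ∑ u, weight δ v u * (bitScore δ (v i) (u i) * bitScore δ (v k) (u k)) =
        if i = k then σ else 0 := by
      intro i k
      split_ifs with h
      · subst h
        simp only [← sq]
        rw [sum_weight_mul_coord v i fun b => bitScore δ (v i) b ^ 2,
          sum_bitWeight_mul_bitScore_sq h0 h1]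
      · rw [sum_weight_mul_coord_mul_coord v h (bitScore δ (v i)) (bitScore δ (v k)),
          sum_bitWeight_mul_bitScore h0 h1, zero_mul]
    calc ∑ u, weight δ v u * g u ^ 2
        = ∑ u, ∑ i, ∑ k, a i * a k *
            (weight δ v u * (bitScore δ (v i) (u i) * bitScore δ (v k) (u k))) := by
          refine Finset.sum_congr rfl fun u _ => ?_
          rw [sq, hg, Finset.sum_mul_sum, Finset.mul_sum]
          refine Finset.sum_congr rfl fun i _ => ?_
          rw [Finset.mul_sum]
          exact Finset.sum_congr rfl fun k _ => by ring
      _ = ∑ i, ∑ k, a i * a k * if i = k then σ else 0 := by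
          rw [Finset.sum_comm]
          refine Finset.sum_congr rfl fun i _ => ?_
          rw [Finset.sum_comm]
          refine Finset.sum_congr rfl fun k _ => ?_
          rw [← Finset.mul_sum, this]
      _ = σ * ∑ i, a i ^ 2 := by
          simp only [mul_ite, mul_zero, Finset.sum_ite_eq, Finset.mem_univ, if_true]
          rw [Finset.mul_sum]
          exact Finset.sum_congr rfl fun i _ => by ring
  have hnn : 0 ≤ ∑ u, weight δ v u * (σ * f u - g u) ^ 2 :=
    Finset.sum_nonneg fun u _ => mul_nonneg (weight_pos h0 h1 v u).le (sq_nonneg _)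
  have hexp : ∑ u, weight δ v u * (σ * f u - g u) ^ 2 =
      σ ^ 2 * ∑ u, weight δ v u * f u ^ 2 - 2 * σ * ∑ u, weight δ v u * (f u * g u) +
        ∑ u, weight δ v u * g u ^ 2 := by
    rw [Finset.mul_sum, Finset.mul_sum, ← Finset.sum_sub_distrib, ← Finset.sum_add_distrib]
    exact Finset.sum_congr rfl fun u _ => by ring
  rw [hexp, hfg, hgg] at hnn
  have : σ * ∑ i, a i ^ 2 ≤ σ * (σ * ∑ u, weight δ v u * f u ^ 2) := by linarith
  exact le_of_mul_le_mul_left this hσpos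

end weight

/-! ### Densities of mutually comparable kernels -/

/-- Kernels `κ`, `η` with `η ≤ e^ε κ` and `κ ≤ e^ε η` have a jointly measurable density with values
in `[e^{-ε}, e^ε]`. -/
lemma exists_density_of_comparable {A β : Type*} [MeasurableSpace A] [MeasurableSpace β]
    [MeasurableSpace.CountableOrCountablyGenerated A β] (κ η : Kernel A β) [IsFiniteKernel κ]
    [IsFiniteKernel η] (ε : ℝ) (hε : 0 ≤ ε)
    (h₁ : ∀ a s, MeasurableSet s → κ a s ≤ ENNReal.ofReal (Real.exp ε) * η a s)
    (h₂ : ∀ a s, MeasurableSet s → η a s ≤ ENNReal.ofReal (Real.exp ε) * κ a s) :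
    ∃ w : A × β → ℝ, Measurable w ∧ (∀ p, Real.exp (-ε) ≤ w p ∧ w p ≤ Real.exp ε) ∧
      ∀ a, κ a = (η a).withDensity fun y => ENNReal.ofReal (w (a, y)) := by
  have hac : ∀ a, κ a ≪ η a := fun a =>
    Measure.AbsolutelyContinuous.mk fun s hs h0 => by
      have := h₁ a s hs
      rw [h0, mul_zero] at this
      exact le_antisymm this zero_le
  -- Truncation makes the bounds hold everywhere; by comparability it alters the Radon-Nikodym
  -- derivative only on a null set.
  refine ⟨fun p => max (Real.exp (-ε)) (min (Real.exp ε) (κ.rnDeriv η p.1 p.2).toReal), ?_, ?_, ?_⟩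
  · have := κ.measurable_rnDeriv η
    fun_prop
  · intro p
    refine ⟨le_max_left _ _, max_le ?_ (min_le_left _ _)⟩
    exact Real.exp_le_exp.2 (by linarith)
  · intro a
    have hset : ∀ s, MeasurableSet s → ∫⁻ y in s, κ.rnDeriv η a y ∂(η a) = κ a s := fun s hs =>
      Kernel.setLIntegral_rnDeriv (hac a) hs
    have hm : Measurable (κ.rnDeriv η a) := κ.measurable_rnDeriv_right η a
    have hub : κ.rnDeriv η a ≤ᵐ[η a] fun _ => ENNReal.ofReal (Real.exp ε) := by
      refine ae_le_of_forall_setLIntegral_le_of_sigmaFinite hm fun s hs _ => ?_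
      rw [hset s hs, setLIntegral_const]
      exact h₁ a s hs
    have hlb : (fun _ => ENNReal.ofReal (Real.exp (-ε))) ≤ᵐ[η a] κ.rnDeriv η a := by
      refine ae_le_of_forall_setLIntegral_le_of_sigmaFinite measurable_const fun s hs _ => ?_
      rw [hset s hs, setLIntegral_const]
      calc ENNReal.ofReal (Real.exp (-ε)) * η a s
          ≤ ENNReal.ofReal (Real.exp (-ε)) * (ENNReal.ofReal (Real.exp ε) * κ a s) := by
            gcongr
            exact h₂ a s hs
        _ = κ a s := by
            rw [← mul_assoc, ← ENNReal.ofReal_mul (Real.exp_pos _).le, ← Real.exp_add]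
            simp
    have hae : (fun y => ENNReal.ofReal (max (Real.exp (-ε))
        (min (Real.exp ε) (κ.rnDeriv η a y).toReal))) =ᵐ[η a] κ.rnDeriv η a := by
      filter_upwards [hub, hlb] with y hy1 hy2
      have htop : κ.rnDeriv η a y ≠ ∞ := ne_top_of_le_ne_top ENNReal.ofReal_ne_top hy1
      rw [min_eq_right (ENNReal.toReal_le_of_le_ofReal (Real.exp_pos _).le hy1),
        max_eq_right ((ENNReal.ofReal_le_iff_le_toReal htop).1 hy2), ENNReal.ofReal_toReal htop]
    show κ a = _
    rw [withDensity_congr_ae hae]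
    ext s hs
    rw [withDensity_apply _ hs, hset s hs]

/-- Kernels that are `e^ε`-comparable with one another have jointly measurable densities with values
in `[e^{-ε}, e^ε]` with respect to any of their mixtures. -/
lemma exists_densities_of_mixture {A β ι : Type*} [MeasurableSpace A] [MeasurableSpace β]
    [MeasurableSpace.CountableOrCountablyGenerated A β] [Fintype ι] (κ : ι → Kernel A β)
    [∀ i, IsFiniteKernel (κ i)] (η : Kernel A β) [IsFiniteKernel η] (ε : ℝ) (hε : 0 ≤ ε)
    (hκ : ∀ i j a s, MeasurableSet s → κ i a s ≤ ENNReal.ofReal (Real.exp ε) * κ j a s)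
    (p : ι → ℝ) (hp : ∀ i, 0 ≤ p i) (hp1 : ∑ i, p i = 1)
    (hη : ∀ a s, MeasurableSet s → η a s = ∑ i, ENNReal.ofReal (p i) * κ i a s) :
    ∃ w : ι → A × β → ℝ, (∀ i, Measurable (w i)) ∧
      (∀ i q, Real.exp (-ε) ≤ w i q ∧ w i q ≤ Real.exp ε) ∧
      (∀ i a, κ i a = (η a).withDensity fun y => ENNReal.ofReal (w i (a, y))) ∧
      ∀ q, ∑ i, p i * w i q = 1 := by
  have hp1' : ∑ i, ENNReal.ofReal (p i) = 1 := by
    rw [← ENNReal.ofReal_sum_of_nonneg fun i _ => hp i, hp1, ENNReal.ofReal_one]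
  have key : ∀ i, ∃ w : A × β → ℝ, Measurable w ∧
      (∀ q, Real.exp (-ε) ≤ w q ∧ w q ≤ Real.exp ε) ∧
      ∀ a, κ i a = (η a).withDensity fun y => ENNReal.ofReal (w (a, y)) := by
    intro i
    refine exists_density_of_comparable (κ i) η ε hε (fun a s hs => ?_) fun a s hs => ?_
    · calc κ i a s = ∑ j, ENNReal.ofReal (p j) * κ i a s := by
            rw [← Finset.sum_mul, hp1', one_mul]
        _ ≤ ∑ j, ENNReal.ofReal (p j) * (ENNReal.ofReal (Real.exp ε) * κ j a s) := by
            gcongr with j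
            exact hκ i j a s hs
        _ = ENNReal.ofReal (Real.exp ε) * η a s := by
            rw [hη a s hs, Finset.mul_sum]
            exact Finset.sum_congr rfl fun j _ => by ring
    · calc η a s = ∑ j, ENNReal.ofReal (p j) * κ j a s := hη a s hs
        _ ≤ ∑ j, ENNReal.ofReal (p j) * (ENNReal.ofReal (Real.exp ε) * κ i a s) := by
            gcongr with j
            exact hκ j i a s hs
        _ = ENNReal.ofReal (Real.exp ε) * κ i a s := by
            rw [← Finset.sum_mul, hp1', one_mul]
  choose w hwm hwb hwd using key
  have hw0 : ∀ i q, 0 ≤ w i q := fun i q => (Real.exp_pos _).le.trans (hwb i q).1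
  set N : Set (A × β) := {q | ∑ i, p i * w i q = 1} with hN
  have hNm : MeasurableSet N :=
    (Finset.measurable_sum _ fun i _ => (hwm i).const_mul _) (measurableSet_singleton 1)
  have hNae : ∀ a, ∀ᵐ y ∂(η a), (a, y) ∈ N := by
    intro a
    have hwm' : ∀ i, Measurable fun y => ENNReal.ofReal (w i (a, y)) := fun i =>
      ((hwm i).comp measurable_prodMk_left).ennreal_ofReal
    have hsum : ∀ y, ENNReal.ofReal (∑ i, p i * w i (a, y)) =
        ∑ i, ENNReal.ofReal (p i) * ENNReal.ofReal (w i (a, y)) := by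
      intro y
      rw [ENNReal.ofReal_sum_of_nonneg fun i _ => mul_nonneg (hp i) (hw0 i _)]
      exact Finset.sum_congr rfl fun i _ => ENNReal.ofReal_mul (hp i)
    have h1 : (fun y => ENNReal.ofReal (∑ i, p i * w i (a, y))) =ᵐ[η a] fun _ => 1 := by
      simp only [hsum]
      refine AEMeasurable.ae_eq_of_forall_setLIntegral_eq
        (Finset.measurable_sum _ fun i _ => (hwm' i).const_mul _).aemeasurable
        aemeasurable_const ?_ (by simp) fun s hs _ => ?_
      · rw [lintegral_finsetSum _ fun i _ => (hwm' i).const_mul _]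
        refine ENNReal.sum_ne_top.2 fun i _ => ?_
        rw [lintegral_const_mul _ (hwm' i), ← setLIntegral_univ, ← withDensity_apply _ .univ,
          ← hwd i a]
        exact ENNReal.mul_ne_top ENNReal.ofReal_ne_top (measure_ne_top _ _)
      · rw [lintegral_finsetSum _ fun i _ => (hwm' i).const_mul _, setLIntegral_one, hη a s hs]
        refine Finset.sum_congr rfl fun i _ => ?_
        rw [lintegral_const_mul _ (hwm' i), ← withDensity_apply _ hs, ← hwd i a]
    filter_upwards [h1] with y hy
    rwa [ENNReal.ofReal_eq_one] at hy
  classical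
  -- The densities average to `1` only almost everywhere. Replacing all of them by `1` off `N` keeps
  -- the bounds and makes the identity pointwise.
  refine ⟨fun i q => if q ∈ N then w i q else 1, fun i => (hwm i).ite hNm measurable_const,
    fun i q => ?_, fun i a => ?_, fun q => ?_⟩
  · dsimp only
    split_ifs
    · exact hwb i q
    · exact ⟨Real.exp_le_one_iff.2 (by linarith), Real.one_le_exp hε⟩
  · rw [hwd i a]
    refine withDensity_congr_ae ?_
    filter_upwards [hNae a] with y hy
    rw [if_pos hy]
  · by_cases hq : q ∈ N
    · simp only [if_pos hq]
      exact hq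
    · simpa only [if_neg hq, mul_one] using hp1

/-- Composing measures and kernels multiplies densities. -/
lemma compProd_withDensity_ofReal {A β : Type*} [MeasurableSpace A] [MeasurableSpace β]
    {μ ν : Measure A} {κ η : Kernel A β} [IsFiniteMeasure μ] [IsFiniteMeasure ν]
    [IsFiniteKernel κ] [IsFiniteKernel η] {f : A → ℝ} {g : A × β → ℝ} (hf : Measurable f)
    (hg : Measurable g) (hf0 : ∀ a, 0 ≤ f a)
    (hν : ν = μ.withDensity fun a => ENNReal.ofReal (f a))
    (hη : ∀ a, η a = (κ a).withDensity fun y => ENNReal.ofReal (g (a, y))) :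
    ν ⊗ₘ η = (μ ⊗ₘ κ).withDensity fun p => ENNReal.ofReal (f p.1 * g p) := by
  ext s hs
  rw [Measure.compProd_apply hs, withDensity_apply _ hs, ← lintegral_indicator hs,
    Measure.lintegral_compProd, hν, lintegral_withDensity_eq_lintegral_mul]
  · refine lintegral_congr fun a => ?_
    simp only [Pi.mul_apply]
    rw [hη a, withDensity_apply _ (measurable_prodMk_left hs),
      ← lintegral_indicator (measurable_prodMk_left hs), ← lintegral_const_mul]
    · refine lintegral_congr fun y => ?_
      by_cases h : (a, y) ∈ s
      · have h' : y ∈ Prod.mk a ⁻¹' s := h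
        rw [Set.indicator_of_mem h, Set.indicator_of_mem h', ENNReal.ofReal_mul (hf0 a)]
      · have h' : y ∉ Prod.mk a ⁻¹' s := h
        rw [Set.indicator_of_notMem h, Set.indicator_of_notMem h', mul_zero]
    · exact Measurable.indicator (by fun_prop) (measurable_prodMk_left hs)
  · fun_prop
  · exact Kernel.measurable_kernel_prodMk_left hs
  · exact Measurable.indicator (by fun_prop) hs

lemma map_withDensity_comp {A β : Type*} [MeasurableSpace A] [MeasurableSpace β] (μ : Measure A)
    {e : A → β} (he : Measurable e) {f : β → ℝ≥0∞} (hf : Measurable f) :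
    (μ.withDensity fun a => f (e a)).map e = (μ.map e).withDensity f := by
  ext s hs
  rw [Measure.map_apply he hs, withDensity_apply _ (he hs), withDensity_apply _ hs,
    setLIntegral_map hs hf he]

/-! ### Elementary inequalities -/

/-- Apply `log y ≤ y - 1` to `y = 1/x` and use `1/x ≤ e < 3`. For a likelihood ratio the linear term
integrates to zero, so relative entropy is at most three times the chi-square divergence. -/
lemma neg_log_le_of_exp_neg_one_le {x : ℝ} (hx : Real.exp (-1) ≤ x) :
    -Real.log x ≤ (1 - x) + 3 * (x - 1) ^ 2 := by
  have hpos : 0 < x := (Real.exp_pos _).trans_le hx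
  have h1 : Real.log x⁻¹ ≤ x⁻¹ - 1 := Real.log_le_sub_one_of_pos (inv_pos.2 hpos)
  rw [Real.log_inv] at h1
  have h2 : x⁻¹ ≤ 3 := by
    rw [inv_le_comm₀ hpos (by norm_num)]
    refine le_trans ?_ hx
    rw [Real.exp_neg]
    refine inv_anti₀ (Real.exp_pos _) ?_
    linarith [Real.exp_one_lt_d9]
  have h3 : x⁻¹ - 1 = (1 - x) + x⁻¹ * (x - 1) ^ 2 := by
    field_simp
    ring
  nlinarith [sq_nonneg (x - 1)]

/-- A two-point testing bound in terms of the likelihood ratio `L`. -/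
lemma one_sub_le_sq_add_sq_mul {L : ℝ} (hL : 0 < L) (r : ℝ) :
    1 - 3 * (L - 1 - Real.log L) ≤ (r - 1) ^ 2 + L * (r + 1) ^ 2 := by
  -- The right side is the minimum over `r`, attained at `r = (1 - L) / (1 + L)`.
  have h1 : (r - 1) ^ 2 + L * (r + 1) ^ 2 ≥ 4 * L / (1 + L) := by
    rw [ge_iff_le, div_le_iff₀ (by linarith)]
    nlinarith [sq_nonneg ((r - 1) + L * (r + 1))]
  refine le_trans ?_ h1
  have h2 : Real.log L ≤ L - 1 := Real.log_le_sub_one_of_pos hL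
  -- For `L ≥ 1/3` the minimum is already at least `1`. For smaller `L`, `log 3 > 1` yields `L - 1 -
  -- log L ≥ 1 - 2L ≥ 1/3`, so the left side is nonpositive.
  rcases le_total (1 / 3) L with h | h
  · have : 1 ≤ 4 * L / (1 + L) := by
      rw [le_div_iff₀ (by linarith)]
      linarith
    linarith
  · have h4 : Real.log (3 * L) ≤ 3 * L - 1 := Real.log_le_sub_one_of_pos (by linarith)
    rw [Real.log_mul (by norm_num) hL.ne'] at h4
    have h5 : 1 < Real.log 3 := by
      rw [Real.lt_log_iff_exp_lt (by norm_num)]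
      linarith [Real.exp_one_lt_d9]
    have h6 : 0 ≤ 4 * L / (1 + L) := by positivity
    nlinarith

/-! ### Oracles that are finite mixtures -/

/-- The oracle that answers a query `x` by `a u x`, for a random sign vector `u` drawn from the
product distribution with bias `δ` towards `v`. -/
noncomputable def signOracle {d : ℕ} {X : Set (E d)} (δ : ℝ)
    (a : (Fin d → Bool) → X → E d) (ha : ∀ u, Measurable (a u)) (v : Fin d → Bool) :
    Kernel X (E d) where
  toFun x := ∑ u, ENNReal.ofReal (weight δ v u) • Measure.dirac (a u x)
  measurable' := by
    refine Measure.measurable_of_measurable_coe _ fun s hs => ?_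
    simp only [Measure.coe_finsetSum, Finset.sum_apply, Measure.smul_apply, smul_eq_mul]
    refine Finset.measurable_sum _ fun u _ => ?_
    exact ((Measure.measurable_coe hs).comp (Measure.measurable_dirac.comp (ha u))).const_mul _

section signOracle

variable {d : ℕ} {X : Set (E d)} {δ : ℝ} {a : (Fin d → Bool) → X → E d}
  {ha : ∀ u, Measurable (a u)}

lemma signOracle_apply (v : Fin d → Bool) (x : X) :
    signOracle δ a ha v x = ∑ u, ENNReal.ofReal (weight δ v u) • Measure.dirac (a u x) := rfl

lemma sum_ofReal_weight (h0 : 0 ≤ δ) (h1 : δ < 1) (v : Fin d → Bool) :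
    ∑ u, ENNReal.ofReal (weight δ v u) = 1 := by
  rw [← ENNReal.ofReal_sum_of_nonneg fun u _ => (weight_pos h0 h1 v u).le, sum_weight,
    ENNReal.ofReal_one]

lemma isMarkovKernel_signOracle (h0 : 0 ≤ δ) (h1 : δ < 1) (v : Fin d → Bool) :
    IsMarkovKernel (signOracle δ a ha v) := by
  refine ⟨fun x => ⟨?_⟩⟩
  simp [signOracle_apply, sum_ofReal_weight h0 h1]

lemma integral_signOracle (h0 : 0 ≤ δ) (h1 : δ < 1) (v : Fin d → Bool) (x : X) :
    ∫ g, g ∂(signOracle δ a ha v x) = ∑ u, weight δ v u • a u x := by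
  rw [signOracle_apply, integral_finsetSum_measure]
  · refine Finset.sum_congr rfl fun u _ => ?_
    rw [integral_smul_measure, integral_dirac, ENNReal.toReal_ofReal (weight_pos h0 h1 v u).le]
  · intro u _
    exact (integrable_dirac (by simp)).smul_measure ENNReal.ofReal_ne_top

lemma ae_signOracle (v : Fin d → Bool) (x : X) {p : E d → Prop} (hp : MeasurableSet {g | p g})
    (h : ∀ u, p (a u x)) : ∀ᵐ g ∂(signOracle δ a ha v x), p g := by
  rw [signOracle_apply, ae_iff]
  simp only [Measure.coe_finsetSum, Finset.sum_apply, Measure.smul_apply, smul_eq_mul]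
  refine Finset.sum_eq_zero fun u _ => ?_
  have : Measure.dirac (a u x) {g | ¬ p g} = 0 := by
    have hc : MeasurableSet {g | ¬ p g} := hp.compl
    rw [Measure.dirac_apply' _ hc]
    simp [h u]
  rw [this, mul_zero]

end signOracle

/-! ### Round kernels and transcripts -/

section transcript

variable {d : ℕ} {X : Set (E d)} {ε : ℝ} {T : ℕ}

lemma ChannelStrategy.isMarkovKernel_kernel (S : ChannelStrategy (ldpChannels d ε) T) (t : Fin T) :
    IsMarkovKernel (S.kernel t) :=
  ⟨fun p => (S.mem t p.1).1.isProbabilityMeasure p.2⟩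

lemma isMarkovKernel_roundKernel (O : Kernel X (E d)) [IsMarkovKernel O] (π : Algorithm X T)
    (S : ChannelStrategy (ldpChannels d ε) T) (t : Fin T) :
    IsMarkovKernel (roundKernel O π S t) := by
  have := S.isMarkovKernel_kernel t
  unfold roundKernel
  infer_instance

lemma roundKernel_apply (O : Kernel X (E d)) [IsMarkovKernel O] (π : Algorithm X T)
    (S : ChannelStrategy (ldpChannels d ε) T) (t : Fin T) (h : π.Seed × (Fin t → E d))
    {s : Set (E d)} (hs : MeasurableSet s) :
    roundKernel O π S t h s = ∫⁻ g, S.channel t h.2 g s ∂(O (π.query t h)) := by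
  have := S.isMarkovKernel_kernel t
  unfold roundKernel
  rw [Kernel.snd_apply' _ _ hs, Kernel.compProd_apply (measurable_snd hs)]
  rfl

lemma measurable_snoc {A β : Type*} [MeasurableSpace A] [MeasurableSpace β] (t : ℕ) :
    Measurable fun p : (A × (Fin t → β)) × β =>
      (p.1.1, (Fin.snoc p.1.2 p.2 : Fin (t + 1) → β)) := by
  refine Measurable.prodMk (by fun_prop) (measurable_pi_iff.2 fun j => ?_)
  induction j using Fin.lastCases with
  | last => simpa using measurable_snd
  | cast j =>
    simp only [Fin.snoc_castSucc]
    fun_prop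

lemma isProbabilityMeasure_transcript (O : Kernel X (E d)) [IsMarkovKernel O] (π : Algorithm X T)
    (S : ChannelStrategy (ldpChannels d ε) T) (t : ℕ) (ht : t ≤ T) :
    IsProbabilityMeasure (transcript O π S t ht) := by
  induction t with
  | zero =>
    unfold transcript
    exact Measure.isProbabilityMeasure_map (by fun_prop)
  | succ t ih =>
    have := ih (Nat.le_of_succ_le ht)
    have := isMarkovKernel_roundKernel O π S ⟨t, ht⟩
    unfold transcript
    refine Measure.isProbabilityMeasure_map (measurable_snoc t).aemeasurable

variable {δ : ℝ} {a : (Fin d → Bool) → X → E d} {ha : ∀ u, Measurable (a u)}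

/-- The vector `v` enters only through the weights. Densities of the components relative to the
mixture at `v` therefore also describe every mixture with a flipped coordinate. -/
lemma roundKernel_signOracle_apply (h0 : 0 ≤ δ) (h1 : δ < 1) (v : Fin d → Bool)
    (π : Algorithm X T) (S : ChannelStrategy (ldpChannels d ε) T) (t : Fin T)
    (h : π.Seed × (Fin t → E d)) {s : Set (E d)} (hs : MeasurableSet s) :
    roundKernel (signOracle δ a ha v) π S t h s =
      ∑ u, ENNReal.ofReal (weight δ v u) * S.channel t h.2 (a u (π.query t h)) s := by
  have := isMarkovKernel_signOracle (a := a) (ha := ha) h0 h1 v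
  rw [roundKernel_apply _ _ _ _ _ hs, signOracle_apply, lintegral_finsetSum_measure]
  refine Finset.sum_congr rfl fun u _ => ?_
  rw [lintegral_smul_measure, lintegral_dirac' _ (Kernel.measurable_coe _ hs), smul_eq_mul]

/-- Under privacy, reversing the bias of one coordinate changes the law of a channel output by a
bounded density, and the squared deviations of these densities from `1` are summable over the
coordinates with a bound that does not depend on the dimension. -/
lemma exists_roundKernel_densities (hε0 : 0 ≤ ε) (hε1 : ε ≤ 1) (h0 : 0 ≤ δ) (h1 : δ ≤ 1 / 2)
    (v : Fin d → Bool) (π : Algorithm X T) (S : ChannelStrategy (ldpChannels d ε) T) (t : Fin T) :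
    ∃ ℓ : Fin d → (π.Seed × (Fin t → E d)) × E d → ℝ, (∀ i, Measurable (ℓ i)) ∧
      (∀ i p, Real.exp (-1) ≤ ℓ i p ∧ ℓ i p ≤ Real.exp 1) ∧
      (∀ i h, roundKernel (signOracle δ a ha (flipBit i v)) π S t h =
        (roundKernel (signOracle δ a ha v) π S t h).withDensity
          fun y => ENNReal.ofReal (ℓ i (h, y))) ∧
      ∀ p, ∑ i, (ℓ i p - 1) ^ 2 ≤ 64 / 3 * δ ^ 2 * ε ^ 2 := by
  have h1' : δ < 1 := by linarith
  have hO := fun v => isMarkovKernel_signOracle (a := a) (ha := ha) h0 h1' v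
  have := isMarkovKernel_roundKernel (signOracle δ a ha v) π S t
  have := S.isMarkovKernel_kernel t
  have hm : ∀ u, Measurable fun h : π.Seed × (Fin t → E d) => (h.2, a u (π.query t h)) := by
    intro u
    have := (ha u).comp (π.measurable_query t)
    exact measurable_snd.prodMk this
  obtain ⟨w, hwm, hwb, hwd, hw1⟩ := exists_densities_of_mixture
    (fun u => (S.kernel t).comap
      (fun h : π.Seed × (Fin t → E d) => (h.2, a u (π.query t h))) (hm u))
    (roundKernel (signOracle δ a ha v) π S t) ε hε0
    (fun u u' h s hs => (S.mem t h.2).2 _ _ s hs) (weight δ v) (fun u => (weight_pos h0 h1' v u).le)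
    (sum_weight v) (fun h s hs => roundKernel_signOracle_apply h0 h1' v π S t h hs)
  have hw0 : ∀ u p, 0 ≤ w u p := fun u p => (Real.exp_pos _).le.trans (hwb u p).1
  refine ⟨fun i p => ∑ u, weight δ (flipBit i v) u * w u p, ?_, ?_, ?_, ?_⟩
  · intro i
    exact Finset.measurable_sum _ fun u _ => (hwm u).const_mul _
  · intro i p
    constructor
    · calc Real.exp (-1) ≤ Real.exp (-ε) := Real.exp_le_exp.2 (by linarith)
        _ = ∑ u, weight δ (flipBit i v) u * Real.exp (-ε) := by
          rw [← Finset.sum_mul, sum_weight, one_mul]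
        _ ≤ _ := Finset.sum_le_sum fun u _ =>
          mul_le_mul_of_nonneg_left (hwb u p).1 (weight_pos h0 h1' _ u).le
    · calc ∑ u, weight δ (flipBit i v) u * w u p
          ≤ ∑ u, weight δ (flipBit i v) u * Real.exp ε := Finset.sum_le_sum fun u _ =>
            mul_le_mul_of_nonneg_left (hwb u p).2 (weight_pos h0 h1' _ u).le
        _ = Real.exp ε := by rw [← Finset.sum_mul, sum_weight, one_mul]
        _ ≤ Real.exp 1 := Real.exp_le_exp.2 hε1
  · intro i h
    ext s hs
    rw [roundKernel_signOracle_apply h0 h1' _ π S t h hs, withDensity_apply _ hs]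
    have hsum : ∀ y, ENNReal.ofReal (∑ u, weight δ (flipBit i v) u * w u (h, y)) =
        ∑ u, ENNReal.ofReal (weight δ (flipBit i v) u) * ENNReal.ofReal (w u (h, y)) := by
      intro y
      rw [ENNReal.ofReal_sum_of_nonneg fun u _ => mul_nonneg (weight_pos h0 h1' _ u).le (hw0 u _)]
      exact Finset.sum_congr rfl fun u _ => ENNReal.ofReal_mul (weight_pos h0 h1' _ u).le
    have hwm' : ∀ u, Measurable fun y => ENNReal.ofReal (w u (h, y)) := fun u =>
      ((hwm u).comp measurable_prodMk_left).ennreal_ofReal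
    simp only [hsum]
    rw [lintegral_finsetSum _ fun u _ => (hwm' u).const_mul _]
    refine Finset.sum_congr rfl fun u _ => ?_
    rw [lintegral_const_mul _ (hwm' u), ← withDensity_apply _ hs, ← hwd u h]
    rfl
  · intro p
    -- Both weights have total mass `1`, so `w` may be replaced by `w - 1`, which is of size `ε`;
    -- this is where privacy enters the Bessel bound.
    have hdev : ∀ i, (∑ u, weight δ (flipBit i v) u * w u p) - 1 =
        ∑ u, (weight δ (flipBit i v) u - weight δ v u) * (w u p - 1) := by
      intro i
      have h2 : ∑ u, (weight δ (flipBit i v) u - weight δ v u) * (w u p - 1) =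
          ∑ u, weight δ (flipBit i v) u * w u p - ∑ u, weight δ v u * w u p -
            ∑ u, weight δ (flipBit i v) u + ∑ u, weight δ v u := by
        rw [← Finset.sum_sub_distrib, ← Finset.sum_sub_distrib, ← Finset.sum_add_distrib]
        exact Finset.sum_congr rfl fun u _ => by ring
      rw [h2, sum_weight, sum_weight, hw1]
      ring
    simp only [hdev]
    refine (sum_sq_sum_weight_flipBit_sub_le h0 h1' v _).trans ?_
    have hsq : ∑ u, weight δ v u * (w u p - 1) ^ 2 ≤ (2 * ε) ^ 2 := by
      calc ∑ u, weight δ v u * (w u p - 1) ^ 2 ≤ ∑ u, weight δ v u * (2 * ε) ^ 2 := by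
            refine Finset.sum_le_sum fun u _ =>
              mul_le_mul_of_nonneg_left ?_ (weight_pos h0 h1' v u).le
            have h2 := Real.abs_exp_sub_one_le (x := ε) (by rwa [abs_of_nonneg hε0])
            have h3 := Real.abs_exp_sub_one_le (x := -ε) (by rwa [abs_neg, abs_of_nonneg hε0])
            rw [abs_neg] at h3
            rw [abs_of_nonneg hε0] at h2 h3
            refine sq_le_sq' ?_ ?_
            · linarith [(hwb u p).1, (abs_le.1 h3).1]
            · linarith [(hwb u p).2, (abs_le.1 h2).2]
        _ = (2 * ε) ^ 2 := by rw [← Finset.sum_mul, sum_weight, one_mul]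
    have hσ : 4 * δ ^ 2 / (1 - δ ^ 2) ≤ 16 / 3 * δ ^ 2 := by
      have h2 : δ ^ 2 ≤ 1 / 4 := by nlinarith
      rw [div_le_iff₀ (by linarith)]
      nlinarith [sq_nonneg δ]
    calc _ ≤ 16 / 3 * δ ^ 2 * (2 * ε) ^ 2 :=
          mul_le_mul hσ hsq (Finset.sum_nonneg fun u _ =>
            mul_nonneg (weight_pos h0 h1' v u).le (sq_nonneg _)) (by positivity)
      _ = 64 / 3 * δ ^ 2 * ε ^ 2 := by ring

end transcript

/-! ### Likelihood ratios of transcripts -/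

section

variable {d : ℕ} {X : Set (E d)} {ε : ℝ} {T : ℕ} {δ : ℝ} {a : (Fin d → Bool) → X → E d}
  {ha : ∀ u, Measurable (a u)}

lemma integrable_of_bounded {A : Type*} [MeasurableSpace A] {μ : Measure A} [IsFiniteMeasure μ]
    {f : A → ℝ} (hf : Measurable f) (C : ℝ) (hC : ∀ x, |f x| ≤ C) : Integrable f μ :=
  Integrable.of_bound hf.aestronglyMeasurable C (Filter.Eventually.of_forall hC)

lemma integral_eq_one_of_withDensity {A : Type*} [MeasurableSpace A] {μ ν : Measure A}
    [IsProbabilityMeasure ν] {f : A → ℝ} (hf : Measurable f) (hf0 : ∀ x, 0 ≤ f x)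
    (h : ν = μ.withDensity fun x => ENNReal.ofReal (f x)) : ∫ x, f x ∂μ = 1 := by
  rw [integral_eq_lintegral_of_nonneg_ae (Filter.Eventually.of_forall hf0) hf.aestronglyMeasurable,
    ← setLIntegral_univ, ← withDensity_apply _ .univ, ← h]
  simp

/-- The laws of the transcripts under the oracles obtained by reversing the bias of one coordinate
have bounded densities, with Kullback-Leibler divergences summing over the coordinates to a bound
that does not depend on the dimension. -/
lemma exists_transcript_densities (hε0 : 0 ≤ ε) (hε1 : ε ≤ 1) (h0 : 0 ≤ δ) (h1 : δ ≤ 1 / 2)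
    (v : Fin d → Bool) (π : Algorithm X T) (S : ChannelStrategy (ldpChannels d ε) T)
    (t : ℕ) (ht : t ≤ T) :
    ∃ L : Fin d → π.Seed × (Fin t → E d) → ℝ, (∀ i, Measurable (L i)) ∧
      (∀ i p, Real.exp (-t) ≤ L i p ∧ L i p ≤ Real.exp t) ∧
      (∀ i, transcript (signOracle δ a ha (flipBit i v)) π S t ht =
        (transcript (signOracle δ a ha v) π S t ht).withDensity
          fun p => ENNReal.ofReal (L i p)) ∧
      ∑ i, ∫ p, -Real.log (L i p) ∂(transcript (signOracle δ a ha v) π S t ht) ≤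
        t * (64 * δ ^ 2 * ε ^ 2) := by
  have h1' : δ < 1 := by linarith
  have hO := fun v => isMarkovKernel_signOracle (a := a) (ha := ha) h0 h1' v
  induction t with
  | zero =>
    refine ⟨fun _ _ => 1, fun _ => measurable_const, by simp, fun i => ?_, by simp⟩
    simp [transcript]
  | succ t ih =>
    have ht' : t ≤ T := Nat.le_of_succ_le ht
    obtain ⟨L, hLm, hLb, hLd, hLs⟩ := ih ht'
    obtain ⟨ℓ, hm, hb, hd, hs⟩ := exists_roundKernel_densities (a := a) (ha := ha) hε0 hε1 h0 h1 v
      π S ⟨t, ht⟩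
    have hP := fun v => isProbabilityMeasure_transcript (signOracle δ a ha v) π S t ht'
    have hK := fun v => isMarkovKernel_roundKernel (signOracle δ a ha v) π S ⟨t, ht⟩
    have hL0 : ∀ i p, 0 < L i p := fun i p => (Real.exp_pos _).trans_le (hLb i p).1
    have hℓ0 : ∀ i p, 0 < ℓ i p := fun i p => (Real.exp_pos _).trans_le (hb i p).1
    set μ := transcript (signOracle δ a ha v) π S t ht' with hμ
    set κ := roundKernel (signOracle δ a ha v) π S ⟨t, ht⟩ with hκ
    set M : Measure ((π.Seed × (Fin t → E d)) × E d) := μ ⊗ₘ κ with hM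
    have hsucc : ∀ v, transcript (signOracle δ a ha v) π S (t + 1) ht =
        ((transcript (signOracle δ a ha v) π S t ht') ⊗ₘ
          (roundKernel (signOracle δ a ha v) π S ⟨t, ht⟩ :
            Kernel (π.Seed × (Fin t → E d)) (E d))).map
        (fun p => (p.1.1, (Fin.snoc p.1.2 p.2 : Fin (t + 1) → E d))) := fun _ => rfl
    -- `e` splits off the last output and undoes `Fin.snoc`; the new likelihood ratio is the old one
    -- times that of the last round.
    set e : (π.Seed × (Fin (t + 1) → E d)) → (π.Seed × (Fin t → E d)) × E d :=
      fun q => ((q.1, fun j => q.2 j.castSucc), q.2 (Fin.last t)) with he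
    have hem : Measurable e := by fun_prop
    have hesnoc : ∀ p : (π.Seed × (Fin t → E d)) × E d,
        e (p.1.1, (Fin.snoc p.1.2 p.2 : Fin (t + 1) → E d)) = p := by
      intro p
      simp [he]
    have hFm : ∀ i, Measurable fun p : (π.Seed × (Fin t → E d)) × E d => L i p.1 * ℓ i p :=
      fun i => ((hLm i).comp measurable_fst).mul (hm i)
    refine ⟨fun i q => L i (e q).1 * ℓ i (e q), fun i => (hFm i).comp hem, fun i q => ?_,
      fun i => ?_, ?_⟩
    · push_cast
      rw [neg_add, Real.exp_add, Real.exp_add]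
      exact ⟨mul_le_mul (hLb i _).1 (hb i _).1 (Real.exp_pos _).le (hL0 i _).le,
        mul_le_mul (hLb i _).2 (hb i _).2 (hℓ0 i _).le (Real.exp_pos _).le⟩
    · have hmap := map_withDensity_comp M (measurable_snoc t)
        (f := fun q => ENNReal.ofReal (L i (e q).1 * ℓ i (e q))) ((hFm i).comp hem).ennreal_ofReal
      simp only [hesnoc] at hmap
      rw [hsucc, compProd_withDensity_ofReal (hLm i) (hm i) (fun p => (hL0 i p).le) (hLd i) (hd i)]
      exact hmap
    · have hlogb : ∀ {x c : ℝ}, Real.exp (-c) ≤ x → x ≤ Real.exp c → |-Real.log x| ≤ c := by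
        intro x c hx1 hx2
        have hx : 0 < x := (Real.exp_pos _).trans_le hx1
        rw [abs_neg, abs_le]
        exact ⟨(Real.le_log_iff_exp_le hx).2 hx1, (Real.log_le_iff_le_exp hx).2 hx2⟩
      have hint1 : ∀ i, Integrable (fun p : (π.Seed × (Fin t → E d)) × E d =>
          -Real.log (L i p.1)) M := fun i =>
        integrable_of_bounded ((hLm i).comp measurable_fst).log.neg t
          fun p => hlogb (hLb i p.1).1 (hLb i p.1).2
      have hint2 : ∀ i, Integrable (fun p => -Real.log (ℓ i p)) M := fun i =>
        integrable_of_bounded (hm i).log.neg 1 fun p => hlogb (hb i p).1 (hb i p).2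
      have hint3 : ∀ i, Integrable (ℓ i) M := fun i =>
        integrable_of_bounded (hm i) (Real.exp 1) fun p => by
          rw [abs_of_pos (hℓ0 i p)]
          exact (hb i p).2
      have hsqb : ∀ i p, (ℓ i p - 1) ^ 2 ≤ 64 / 3 * δ ^ 2 * ε ^ 2 := fun i p =>
        (Finset.single_le_sum (f := fun i => (ℓ i p - 1) ^ 2) (fun _ _ => sq_nonneg _)
          (Finset.mem_univ i)).trans (hs p)
      have hint4 : ∀ i, Integrable (fun p => (ℓ i p - 1) ^ 2) M := fun i =>
        integrable_of_bounded (((hm i).sub_const 1).pow_const 2) (64 / 3 * δ ^ 2 * ε ^ 2)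
          fun p => by
            rw [abs_of_nonneg (sq_nonneg _)]
            exact hsqb i p
      -- Keep the law of the past and flip only the last round: the resulting probability measure
      -- has density `ℓ i` with respect to `M`.
      have hone : ∀ i, ∫ p, ℓ i p ∂M = 1 := fun i => by
        have hMd := compProd_withDensity_ofReal (μ := μ) (ν := μ) (f := fun _ => 1)
          measurable_const (hm i) (fun _ => zero_le_one) (by simp) (hd i)
        simp only [one_mul] at hMd
        exact integral_eq_one_of_withDensity (hm i) (fun p => (hℓ0 i p).le) hMd
      have hint5 : ∀ i, Integrable (fun p => 1 - ℓ i p) M := fun i =>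
        (integrable_const 1).sub (hint3 i)
      -- The sum over `i` must go inside the integral, since the dimension-free bound is pointwise
      -- in the transcript but holds for the whole sum. The constant is `64 = 3 · 64/3`.
      have hround : ∑ i, ∫ p, -Real.log (ℓ i p) ∂M ≤ 64 * δ ^ 2 * ε ^ 2 := by
        calc ∑ i, ∫ p, -Real.log (ℓ i p) ∂M
            ≤ ∑ i, ∫ p, ((1 - ℓ i p) + 3 * (ℓ i p - 1) ^ 2) ∂M :=
              Finset.sum_le_sum fun i _ => integral_mono (hint2 i)
                ((hint5 i).add ((hint4 i).const_mul 3))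
                fun p => neg_log_le_of_exp_neg_one_le (hb i p).1
          _ = ∑ i, ∫ p, 3 * (ℓ i p - 1) ^ 2 ∂M := by
              refine Finset.sum_congr rfl fun i _ => ?_
              rw [integral_add (hint5 i) ((hint4 i).const_mul 3),
                integral_sub (integrable_const 1) (hint3 i), hone]
              simp
          _ = ∫ p, ∑ i, 3 * (ℓ i p - 1) ^ 2 ∂M :=
              (integral_finsetSum _ fun i _ => (hint4 i).const_mul 3).symm
          _ ≤ ∫ _, 64 * δ ^ 2 * ε ^ 2 ∂M := by
              refine integral_mono (integrable_finsetSum _ fun i _ => (hint4 i).const_mul 3)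
                (integrable_const _) fun p => ?_
              dsimp only
              rw [← Finset.mul_sum]
              linarith [hs p]
          _ = 64 * δ ^ 2 * ε ^ 2 := by simp
      -- Chain rule for relative entropy.
      have hsplit : ∀ i, ∫ q, -Real.log (L i (e q).1 * ℓ i (e q))
            ∂(transcript (signOracle δ a ha v) π S (t + 1) ht) =
          ∫ p, -Real.log (L i p) ∂μ + ∫ p, -Real.log (ℓ i p) ∂M := by
        intro i
        have hfst : ∫ p, -Real.log (L i p) ∂μ = ∫ p, -Real.log (L i p.1) ∂M := by
          rw [← integral_map (φ := Prod.fst) (μ := M) (f := fun p => -Real.log (L i p))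
            measurable_fst.aemeasurable (hLm i).log.neg.aestronglyMeasurable]
          have : M.map Prod.fst = μ := Measure.fst_compProd μ κ
          rw [this]
        have hFlog : Measurable fun q => -Real.log (L i (e q).1 * ℓ i (e q)) :=
          ((hFm i).comp hem).log.neg
        rw [hfst, ← integral_add (hint1 i) (hint2 i), hsucc,
          integral_map (measurable_snoc t).aemeasurable hFlog.aestronglyMeasurable]
        refine integral_congr_ae (Filter.Eventually.of_forall fun p => ?_)
        simp only [hesnoc]
        rw [Real.log_mul (hL0 i _).ne' (hℓ0 i _).ne', neg_add]
      simp only [hsplit]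
      rw [Finset.sum_add_distrib]
      push_cast
      linarith

/-- Assouad-type bound: some sign vector cannot be estimated from the transcript. -/
lemma exists_le_sum_integral_sq_sub_sgn (hε0 : 0 ≤ ε) (hε1 : ε ≤ 1) (h0 : 0 ≤ δ) (h1 : δ ≤ 1 / 2)
    (hT : 384 * T * δ ^ 2 * ε ^ 2 ≤ d) (π : Algorithm X T)
    (S : ChannelStrategy (ldpChannels d ε) T) (r : π.Seed × (Fin T → E d) → Fin d → ℝ)
    (hr : ∀ i, Measurable fun p => r p i) (C : ℝ) (hC : ∀ p i, |r p i| ≤ C) :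
    ∃ v, (d : ℝ) / 4 ≤ ∑ i, ∫ p, (r p i - sgn (v i)) ^ 2
      ∂(transcript (signOracle δ a ha v) π S T le_rfl) := by
  have h1' : δ < 1 := by linarith
  have hO := fun v => isMarkovKernel_signOracle (a := a) (ha := ha) h0 h1' v
  have hP := fun v => isProbabilityMeasure_transcript (signOracle δ a ha v) π S T le_rfl
  set P := fun v => transcript (signOracle δ a ha v) π S T le_rfl with hPdef
  have hP' : ∀ v, IsProbabilityMeasure (P v) := hP
  set A : (Fin d → Bool) → Fin d → ℝ := fun v i => ∫ p, (r p i - sgn (v i)) ^ 2 ∂(P v) with hA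
  have hpair : ∀ v, (d : ℝ) / 2 ≤ ∑ i, (A v i + A (flipBit i v) i) := by
    intro v
    obtain ⟨L, hLm, hLb, hLd, hLs⟩ := exists_transcript_densities (a := a) (ha := ha) hε0 hε1 h0 h1
      v π S T le_rfl
    have hL0 : ∀ i p, 0 < L i p := fun i p => (Real.exp_pos _).trans_le (hLb i p).1
    have hLint : ∀ i, Integrable (L i) (P v) := fun i =>
      integrable_of_bounded (hLm i) (Real.exp T) fun p => by
        rw [abs_of_pos (hL0 i p)]
        exact (hLb i p).2
    have hlogint : ∀ i, Integrable (fun p => Real.log (L i p)) (P v) := fun i =>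
      integrable_of_bounded (hLm i).log T fun p => by
        rw [abs_le]
        exact ⟨(Real.le_log_iff_exp_le (hL0 i p)).2 (hLb i p).1,
          (Real.log_le_iff_le_exp (hL0 i p)).2 (hLb i p).2⟩
    have hone : ∀ i, ∫ p, L i p ∂(P v) = 1 := fun i =>
      integral_eq_one_of_withDensity (hLm i) (fun p => (hL0 i p).le) (hLd i)
    have hsqm : ∀ i c, Measurable fun p => (r p i - c) ^ 2 := fun i c =>
      ((hr i).sub_const c).pow_const 2
    have hsqb : ∀ i b p, |(r p i - sgn b) ^ 2| ≤ (C + 1) ^ 2 := by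
      intro i b p
      rw [abs_of_nonneg (sq_nonneg _), sq_le_sq]
      have h2 : |sgn b| = 1 := by cases b <;> simp [sgn]
      have h3 : |r p i - sgn b| ≤ |r p i| + |sgn b| := abs_sub _ _
      have h4 := le_abs_self (C + 1)
      linarith [hC p i]
    have hflip : ∀ i, A (flipBit i v) i = ∫ p, L i p * (r p i + sgn (v i)) ^ 2 ∂(P v) := by
      intro i
      have h2 : P (flipBit i v) = _ := hLd i
      simp only [hA, h2]
      rw [integral_withDensity_eq_integral_toReal_smul (hLm i).ennreal_ofReal (by simp)]
      refine integral_congr_ae (Filter.Eventually.of_forall fun p => ?_)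
      simp only [ENNReal.toReal_ofReal (hL0 i p).le, smul_eq_mul, flipBit, Function.update_self,
        sgn_not, sub_neg_eq_add]
    have hle : ∀ i, 1 - 3 * ∫ p, -Real.log (L i p) ∂(P v) ≤ A v i + A (flipBit i v) i := by
      intro i
      have hi1 : Integrable (fun p => (r p i - sgn (v i)) ^ 2) (P v) :=
        integrable_of_bounded (hsqm i _) _ (hsqb i (v i))
      have hi2 : Integrable (fun p => L i p * (r p i + sgn (v i)) ^ 2) (P v) := by
        refine integrable_of_bounded ((hLm i).mul (((hr i).add_const _).pow_const 2))
          (Real.exp T * (C + 1) ^ 2) fun p => ?_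
        have := hsqb i (!(v i)) p
        rw [sgn_not, sub_neg_eq_add] at this
        rw [abs_mul, abs_of_pos (hL0 i p)]
        exact mul_le_mul (hLb i p).2 this (abs_nonneg _) (Real.exp_pos _).le
      rw [hflip, ← integral_add hi1 hi2]
      have hi4 : Integrable (fun p => L i p - 1) (P v) := (hLint i).sub (integrable_const 1)
      have hi3 : Integrable (fun p => 3 * (L i p - 1 - Real.log (L i p))) (P v) :=
        (hi4.sub (hlogint i)).const_mul 3
      calc 1 - 3 * ∫ p, -Real.log (L i p) ∂(P v)
          = ∫ p, (1 - 3 * (L i p - 1 - Real.log (L i p))) ∂(P v) := by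
            rw [integral_sub (integrable_const 1) hi3, integral_const_mul,
              integral_sub hi4 (hlogint i),
              integral_sub (hLint i) (integrable_const 1), hone, integral_neg]
            simp
        _ ≤ _ := by
            refine integral_mono ((integrable_const 1).sub hi3) (hi1.add hi2) fun p => ?_
            -- Multiplying the estimate by `sgn (v i)` reduces to the case of true sign `1` against
            -- `-1`.
            have h2 := one_sub_le_sq_add_sq_mul (hL0 i p) (r p i * sgn (v i))
            have h3 : (r p i * sgn (v i) - 1) ^ 2 = (r p i - sgn (v i)) ^ 2 := by
              linear_combination (r p i ^ 2 - 1) * sgn_sq (v i)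
            have h4 : (r p i * sgn (v i) + 1) ^ 2 = (r p i + sgn (v i)) ^ 2 := by
              linear_combination (r p i ^ 2 - 1) * sgn_sq (v i)
            rwa [h3, h4] at h2
    -- The loss is at most `3 · 64 T δ² ε² = 192 T δ² ε²`, which `hT` bounds by `d / 2`.
    calc (d : ℝ) / 2 ≤ ∑ i, (1 - 3 * ∫ p, -Real.log (L i p) ∂(P v)) := by
          rw [Finset.sum_sub_distrib, ← Finset.mul_sum]
          have h2 : ∑ i, ∫ p, -Real.log (L i p) ∂(P v) ≤ T * (64 * δ ^ 2 * ε ^ 2) := hLs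
          simp only [Finset.sum_const, Finset.card_univ, Fintype.card_fin, nsmul_eq_mul, mul_one]
          linarith
      _ ≤ _ := Finset.sum_le_sum fun i _ => hle i
  -- Flipping a bit permutes the cube, so averaging the pair bounds over `v` counts each error twice
  -- and leaves `d / 4` on average.
  have hflipsum : ∑ v, ∑ i, A (flipBit i v) i = ∑ v, ∑ i, A v i := by
    rw [Finset.sum_comm, Finset.sum_comm (f := fun v i => A v i)]
    refine Finset.sum_congr rfl fun i _ => ?_
    exact Equiv.sum_comp (flipBit_involutive i).toPerm fun v => A v i
  have hsum : ∑ _v : Fin d → Bool, (d : ℝ) / 4 ≤ ∑ v, ∑ i, A v i := by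
    have h2 := Finset.sum_le_sum fun v (_ : v ∈ Finset.univ) => hpair v
    simp only [Finset.sum_add_distrib] at h2
    rw [hflipsum] at h2
    have h3 : ∑ _v : Fin d → Bool, (d : ℝ) / 2 = 2 * ∑ _v : Fin d → Bool, (d : ℝ) / 4 := by
      rw [Finset.mul_sum]
      exact Finset.sum_congr rfl fun _ _ => by ring
    linarith
  obtain ⟨v, -, hv⟩ := Finset.exists_le_of_sum_le Finset.univ_nonempty hsum
  exact ⟨v, hv⟩

end

/-! ### The hard instances -/

section

variable {d : ℕ}

/-- The vector of `{±1}^d` encoded by a Boolean vector. -/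
noncomputable def signVec (v : Fin d → Bool) : E d := WithLp.toLp 2 fun i => sgn (v i)

lemma signVec_apply (v : Fin d → Bool) (i : Fin d) : signVec v i = sgn (v i) := rfl

lemma norm_signVec (v : Fin d → Bool) : ‖signVec v‖ = √d := by
  rw [EuclideanSpace.norm_eq]
  simp [signVec_apply, sgn_sq]

/-- The gradient estimate at `x` determined by the sign vector `u`. If `u` has bias `δ` towards `v`,
its mean is the gradient at `x` of `x ↦ α/2 ‖x - (c δ / α) v‖²`. -/
noncomputable def hardAnswer {X : Set (E d)} (α c : ℝ) (u : Fin d → Bool) (x : X) : E d :=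
  α • (x : E d) - c • signVec u

lemma measurable_hardAnswer {X : Set (E d)} (α c : ℝ) (u : Fin d → Bool) :
    Measurable (hardAnswer (X := X) α c u) := by
  unfold hardAnswer
  fun_prop

lemma sum_weight_smul_hardAnswer {X : Set (E d)} (α c δ : ℝ) (v : Fin d → Bool) (x : X) :
    ∑ u, weight δ v u • hardAnswer α c u x = α • (x : E d) - (c * δ) • signVec v := by
  have h : ∑ u, weight δ v u • signVec u = δ • signVec v := by
    ext i
    simp only [WithLp.ofLp_sum, WithLp.ofLp_smul, Finset.sum_apply, Pi.smul_apply, smul_eq_mul,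
      signVec_apply, sum_weight_mul_sgn]
  simp only [hardAnswer, smul_sub, Finset.sum_sub_distrib]
  rw [← Finset.sum_smul, sum_weight, one_smul, mul_smul, ← h, Finset.smul_sum]
  congr 1
  exact Finset.sum_congr rfl fun u _ => smul_comm _ _ _

/-- The quadratic with curvature `α` and minimizer `z`. -/
noncomputable def quadratic (α : ℝ) (z x : E d) : ℝ := α / 2 * ‖x - z‖ ^ 2

/-- The squared norms cancel and an affine function remains. -/
lemma convexOn_quadratic_sub {X : Set (E d)} (hX : Convex ℝ X) (α : ℝ) (z : E d) :
    ConvexOn ℝ X fun x => quadratic α z x - α / 2 * ‖x‖ ^ 2 := by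
  have h : (fun x => quadratic α z x - α / 2 * ‖x‖ ^ 2) =
      fun x => ((-α) • innerSL ℝ z).toLinearMap x + α / 2 * ‖z‖ ^ 2 := by
    funext x
    simp only [quadratic, ContinuousLinearMap.coe_coe, _root_.smul_apply,
      innerSL_apply_apply, smul_eq_mul]
    rw [norm_sub_sq_real, real_inner_comm]
    ring
  rw [h]
  exact (LinearMap.convexOn _ hX).add_const _

lemma convexOn_quadratic {X : Set (E d)} (hX : Convex ℝ X) {α : ℝ} (hα : 0 ≤ α) (z : E d) :
    ConvexOn ℝ X (quadratic α z) := by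
  have h : quadratic α z =
      (fun x => quadratic α z x - α / 2 * ‖x‖ ^ 2) + fun x => (α / 2) • ‖x‖ ^ 2 := by
    funext x
    simp
  rw [h]
  exact (convexOn_quadratic_sub hX α z).add
    (((convexOn_norm hX).pow (fun _ _ => norm_nonneg _) 2).smul (by positivity))

lemma smul_sub_mem_subgradients_quadratic (X : Set (E d)) {α : ℝ} (hα : 0 ≤ α) (z x : E d) :
    α • (x - z) ∈ subgradients X (quadratic α z) x := by
  intro y _
  have h : y - z = (x - z) + (y - x) := by abel
  simp only [quadratic]
  rw [h, norm_add_sq_real, real_inner_smul_left]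
  nlinarith [mul_nonneg hα (sq_nonneg ‖y - x‖)]

/-- Every sign vector has norm `√d`, so answers have norm at most `α R + c √d`; `hB` divides the
budget `B` between curvature and noise. -/
lemma hard_mem_stronglyConvexClass {B α c δ R : ℝ} (hα : 0 < α) (hc : 0 ≤ c) (h0 : 0 ≤ δ)
    (h1 : δ < 1) (hB : α * R + c * √d ≤ B) (v : Fin d → Bool) :
    (quadratic α ((c * δ / α) • signVec v),
      signOracle δ (hardAnswer α c) (measurable_hardAnswer α c) v) ∈
      stronglyConvexClass (Metric.closedBall (0 : E d) R) B α := by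
  have hX : Convex ℝ (Metric.closedBall (0 : E d) R) := convex_closedBall _ _
  refine ⟨convexOn_quadratic hX hα.le _, convexOn_quadratic_sub hX α _,
    isMarkovKernel_signOracle (ha := measurable_hardAnswer α c) h0 h1 v, fun x => ?_, fun x => ?_⟩
  · rw [integral_signOracle h0 h1, sum_weight_smul_hardAnswer]
    have h : α • (x : E d) - (c * δ) • signVec v =
        α • ((x : E d) - (c * δ / α) • signVec v) := by
      rw [smul_sub, smul_smul, mul_div_cancel₀ _ hα.ne']
    rw [h]
    exact smul_sub_mem_subgradients_quadratic _ hα.le _ _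
  · refine ae_signOracle (ha := measurable_hardAnswer α c) v x
      (measurableSet_le (by fun_prop) measurable_const) fun u => ?_
    have hx : ‖(x : E d)‖ ≤ R := mem_closedBall_zero_iff.1 x.2
    have h : ‖hardAnswer α c u x‖ ≤ B := by
      calc ‖hardAnswer α c u x‖ ≤ ‖α • (x : E d)‖ + ‖c • signVec u‖ := norm_sub_le _ _
        _ = α * ‖(x : E d)‖ + c * √d := by
          rw [norm_smul, norm_smul, norm_signVec, Real.norm_of_nonneg hα.le, Real.norm_of_nonneg hc]
        _ ≤ α * R + c * √d := by gcongr
        _ ≤ B := hB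
    gcongr

/-- This is the passage from optimization to estimation of `v` by `x / b`. -/
lemma quadratic_smul_signVec (α : ℝ) {b : ℝ} (hb : b ≠ 0) (v : Fin d → Bool) (x : E d) :
    quadratic α (b • signVec v) x = α / 2 * b ^ 2 * ∑ i, (x i / b - sgn (v i)) ^ 2 := by
  rw [quadratic, EuclideanSpace.norm_sq_eq, Finset.mul_sum, Finset.mul_sum]
  refine Finset.sum_congr rfl fun i _ => ?_
  simp only [PiLp.sub_apply, PiLp.smul_apply, signVec_apply, smul_eq_mul, Real.norm_eq_abs, sq_abs]
  field_simp

/-- Lower bound on the minmax error over a ball, in terms of the bias `δ` of the hard oracles. -/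
lemma le_minmaxError_closedBall {B α c δ R ε : ℝ} {T : ℕ} (hα : 0 < α) (hc : 0 < c) (h0 : 0 < δ)
    (h1 : δ ≤ 1 / 2) (hB : α * R + c * √d ≤ B) (hR : c * δ / α * √d ≤ R) (hε0 : 0 ≤ ε)
    (hε1 : ε ≤ 1) (hT : 384 * T * δ ^ 2 * ε ^ 2 ≤ d) :
    ENNReal.ofReal (α / 2 * (c * δ / α) ^ 2 * (d / 4)) ≤
      minmaxError (Metric.closedBall (0 : E d) R)
        (stronglyConvexClass (Metric.closedBall (0 : E d) R) B α) T (ldpChannels d ε) := by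
  set X := Metric.closedBall (0 : E d) R with hX
  set b : ℝ := c * δ / α with hb
  have hbpos : 0 < b := by positivity
  have h1' : δ < 1 := by linarith
  refine le_iInf₂ fun π S => ?_
  have hout : Measurable fun p => (π.output p : E d) :=
    measurable_subtype_coe.comp π.measurable_output
  have hrm : ∀ i, Measurable fun p => (π.output p : E d) i / b := fun i => by fun_prop
  have hrb : ∀ p i, |(π.output p : E d) i / b| ≤ R / b := by
    intro p i
    rw [abs_div, abs_of_pos hbpos]
    have h2 : ‖(π.output p : E d)‖ ≤ R := 
      mem_closedBall_zero_iff.1 (π.output p).2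
    have h3 : |(π.output p : E d) i| ≤ ‖(π.output p : E d)‖ := 
      PiLp.norm_apply_le (π.output p : E d) i
    gcongr
    exact h3.trans h2
  obtain ⟨v, hv⟩ := exists_le_sum_integral_sq_sub_sgn (a := hardAnswer α c)
    (ha := measurable_hardAnswer α c) hε0 hε1 h0.le h1 hT π S
    (fun p i => (π.output p : E d) i / b) hrm (R / b) hrb
  refine le_iSup₂_of_le _ (hard_mem_stronglyConvexClass hα hc.le h0.le h1' hB v) ?_
  have := isMarkovKernel_signOracle (a := hardAnswer (X := X) α c)
    (ha := measurable_hardAnswer α c) h0.le h1' v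
  have := isProbabilityMeasure_transcript
    (signOracle δ (hardAnswer (X := X) α c) (measurable_hardAnswer α c) v) π S T le_rfl
  set P := transcript (signOracle δ (hardAnswer (X := X) α c) (measurable_hardAnswer α c) v) π S T
    le_rfl with hP
  -- By `hR` the minimizer lies in the ball, so the gap is no smaller than the value of the
  -- quadratic.
  have hinf : ⨅ z : X, quadratic α (b • signVec v) z ≤ 0 := by
    have hmem : b • signVec v ∈ X := by
      rw [hX, mem_closedBall_zero_iff, norm_smul, norm_signVec, Real.norm_of_nonneg hbpos.le]
      exact hR
    refine (ciInf_le ⟨0, ?_⟩ ⟨_, hmem⟩).trans (by simp [quadratic])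
    rintro _ ⟨z, rfl⟩
    simp only [quadratic]
    positivity
  have hint : ∀ i, Integrable (fun p => ((π.output p : E d) i / b - sgn (v i)) ^ 2) P := by
    intro i
    refine integrable_of_bounded (((hrm i).sub_const _).pow_const 2) ((R / b + 1) ^ 2) fun p => ?_
    rw [abs_of_nonneg (sq_nonneg _), sq_le_sq]
    have h2 : |sgn (v i)| = 1 := by cases v i <;> simp [sgn]
    have h3 := abs_sub ((π.output p : E d) i / b) (sgn (v i))
    have h4 := le_abs_self (R / b + 1)
    linarith [hrb p i]
  calc ENNReal.ofReal (α / 2 * b ^ 2 * (d / 4))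
      ≤ ENNReal.ofReal (∫ p, quadratic α (b • signVec v) (π.output p) ∂P) := by
        refine ENNReal.ofReal_le_ofReal ?_
        simp only [quadratic_smul_signVec α hbpos.ne']
        rw [integral_const_mul, integral_finsetSum _ fun i _ => hint i]
        gcongr
    _ = ∫⁻ p, ENNReal.ofReal (quadratic α (b • signVec v) (π.output p)) ∂P := by
        refine ofReal_integral_eq_lintegral_ofReal ?_ (Filter.Eventually.of_forall fun p => ?_)
        · simp only [quadratic_smul_signVec α hbpos.ne']
          exact (integrable_finsetSum _ fun i _ => hint i).const_mul _
        · simp only [quadratic, Pi.zero_apply]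
          positivity
    _ ≤ _ := by
        refine lintegral_mono fun p => ENNReal.ofReal_le_ofReal ?_
        dsimp only
        linarith

end

end PrivOpt

theorem theoremt :
    ∃ c₀ c₁ : ℝ, 0 < c₀ ∧ 0 < c₁ ∧
      ∀ (d : ℕ) (B α D ε : ℝ) (T : ℕ),
        0 < B → 0 < α → 0 < D → 0 ≤ ε → ε ≤ 1 →
        D / 8 ≤ B / α →
        c₀ * (B ^ 2 / (α ^ 2 * D ^ 2)) * (d / ε ^ 2) ≤ T →
        ENNReal.ofReal (c₁ * (B ^ 2 / (α * T)) * (d / ε ^ 2)) ≤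
          ⨆ X ∈ PrivOpt.domains₂ d D,
            PrivOpt.minmaxError X (PrivOpt.stronglyConvexClass X B α) T
              (PrivOpt.ldpChannels d ε) := by
  -- `12288 = 32 · 384`: with `c = B / (2√d)` the bound `α b² d / 8` equals `B² δ² / (32 α)`, and
  -- `384` comes from `δ²`.
  refine ⟨1, 1 / 12288, one_pos, by norm_num, ?_⟩
  intro d B α D ε T hB hα hD hε0 hε1 hBD hT
  by_cases hdeg : d = 0 ∨ ε = 0 ∨ T = 0
  -- Division by zero is zero, so the claimed lower bound vanishes in these cases.
  · rcases hdeg with rfl | rfl | rfl <;> simp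
  push Not at hdeg
  obtain ⟨hd, hε, hT0⟩ := hdeg
  have hd' : (0 : ℝ) < d := by exact_mod_cast Nat.pos_of_ne_zero hd
  have hT' : (0 : ℝ) < T := by exact_mod_cast Nat.pos_of_ne_zero hT0
  have hε' : 0 < ε := lt_of_le_of_ne hε0 hε.symm
  have hDα : α * D ≤ 8 * B := by
    rw [div_le_div_iff₀ (by norm_num) hα] at hBD
    linarith
  -- The largest bias allowed by the Assouad bound: `384 T δ² ε² = d`.
  set δ : ℝ := √(d / (384 * T * ε ^ 2)) with hδ
  have hδsq : δ ^ 2 = d / (384 * T * ε ^ 2) := Real.sq_sqrt (by positivity)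
  have hδpos : 0 < δ := Real.sqrt_pos.2 (by positivity)
  -- The assumption on `T` gives `δ² ≤ α² D² / (384 B²)`, and `384 ≥ 16²`. This bound keeps the
  -- minimizer in the ball and, with `α D ≤ 8 B`, yields `δ ≤ 1/2`.
  have hδle : δ ≤ D * α / (16 * B) := by
    refine (pow_le_pow_iff_left₀ hδpos.le (by positivity) two_ne_zero).1 ?_
    rw [one_mul, div_mul_div_comm, div_le_iff₀ (by positivity)] at hT
    rw [hδsq, div_pow, div_le_div_iff₀ (by positivity) (by positivity)]
    nlinarith [show 0 ≤ B ^ 2 * d by positivity]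
  have hδhalf : δ ≤ 1 / 2 := by
    refine hδle.trans ?_
    rw [div_le_iff₀ (by positivity)]
    linarith
  have hsd : 0 < √(d : ℝ) := Real.sqrt_pos.2 hd'
  -- With radius `D / 16` the term `α x` has norm at most `B / 2`; the other half of the budget is
  -- spent on `c √d = B / 2`.
  refine le_iSup₂_of_le (Metric.closedBall (0 : PrivOpt.E d) (D / 16)) ⟨?_, ?_⟩ ?_
  · exact ⟨0, by simp; positivity⟩
  · intro x hx y hy
    rw [mem_closedBall_zero_iff] at hx hy
    linarith [norm_sub_le x y]
  · refine le_trans (le_of_eq ?_) (PrivOpt.le_minmaxError_closedBall (c := B / (2 * √d)) (δ := δ)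
      hα (by positivity) hδpos hδhalf ?_ ?_ hε0 hε1 ?_)
    · congr 1
      rw [div_pow, mul_pow, div_pow, mul_pow, Real.sq_sqrt hd'.le, hδsq]
      field_simp
      norm_num
    · have : B / (2 * √d) * √d = B / 2 := by field_simp
      rw [this]
      linarith
    · have : B / (2 * √d) * δ / α * √d = B / (2 * α) * δ := by field_simp
      rw [this]
      calc B / (2 * α) * δ ≤ B / (2 * α) * (D * α / (16 * B)) := by gcongr
        _ = D / 32 := by
          field_simp
          norm_num
        _ ≤ D / 16 := by linarith
    · rw [hδsq]
      refine le_of_eq ?_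
      field_simp
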